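/- Let $M\in\mathbb N$, let $A\in\mathbb R^{M\times M}$ be diagonal, $W\in\mathbb R^{M\times M}$, $h\in\mathbb R^M$, and consider the piecewise-linear recurrent network $Z_{t+1}=AZ_t+W\max(Z_t,0)+h$ (maximum taken entrywise) with time step $\Delta t>0$. For $\Omega\subseteq\{1,\dots,M\}$ let $D_\Omega$ be the diagonal matrix with entries $1$ at the indices in $\Omega$ and $0$ elsewhere, and put $W_\Omega=A+WD_\Omega$, so that on the sub-region $S_\Omega=\{Z: Z_i>0\Leftrightarrow i\in\Omega\}$ the network is the affine map $Z\mapsto W_\Omega Z+h$. Suppose that $W_\Omega$ is invertible and diagonalizable (over $\mathbb C$) and has the eigenvalue $1$, i.e. $\det(I-W_\Omega)=0$, and let $n$ be the multiplicity of this eigenvalue. Let $t_0\in\mathbb R$. For an invertible complex $M\times M$ matrix $V$ whose first $n$ columns form a basis of the eigenspace of $W_\Omega$ for the eigenvalue $1$ (for instance a matrix of eigenvectors of $W_\Omega$ in which those for the eigenvalue $1$ come first; such matrices exist), let $$E_V=V\begin{pmatrix}I_n&0\\0&0\end{pmatrix}V^{-1},\qquad E_V'=V\begin{pmatrix}0_{n\times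 n}&0\\0&I\end{pmatrix}V^{-1}$$ be the block matrices $\mathrm{diag}(I_n,0)$ and $\mathrm{diag}(0_{n\times n},I)$ written with respect to the basis of columns of $V$. Then there exist a logarithm $\log W_\Omega$ of $W_\Omega$ (a complex matrix whose exponential is $W_\Omega$), $\tilde W\in\mathbb C^{M\times M}$ and $\tilde h\in\mathbb C^M$ such that 1. the system $\dot\zeta=\tilde W\zeta+\tilde h$ is equivalent to $Z\mapsto W_\Omega Z+h$ on $[t_0,t_0+\Delta t]$: for every $Z\in\mathbb R^M$ it has a solution on this interval with $\zeta(t_0)=Z$, and each such solution satisfies $\zeta(t_0+\Delta t)=W_\Omega Z+h$; 2. $\tilde W=\frac1{\Delta t}\log W_\Omega$, and $\tilde W$ is diagonalizable but not invertible, its eigenvalue $0$ having multiplicity $n$; 3. for every $V$ as above the matrix $E_V'-W_\Omega$ is invertible and $$\tilde h=-\frac1{\Delta t}\bigl[E_V+\log W_\Omega\bigr]\bigl[E_V'-W_\Omega\bigr]^{-1}h .$$ If, moreover, in the Jordan form of $W_\Omega$ every $k\times k$ Jordan block associated with a negative real eigenvalue occurs an even number of times, then $\log W_\Omega$, $\tilde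 W$, $\tilde h$ with properties 1–3 can be chosen such that $\tilde W$ is real. Furthermore, any logarithm of $W_\Omega$ whose eigenvalue $0$ has multiplicity exactly $n$ (for example the principal one) can be used: with it, properties 1–3 hold for $\tilde W=\frac1{\Delta t}\log W_\Omega$ and some $\tilde h\in\mathbb C^M$. -/

import Mathlib

open Matrix

noncomputable section

/-- The recurrence matrix `W_Ω = A + W D_Ω` of the piecewise-linear RNN
`Z ↦ A Z + W max(Z, 0) + h` with `A = diag(a)`, on the sub-region where exactly the coordinates in
`Ω` are positive. -/
def recurrenceMatrix {M : ℕ} (a : Fin M → ℝ) (W : Matrix (Fin M) (Fin M) ℝ) (Ω : Finset (Fin M)) :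
    Matrix (Fin M) (Fin M) ℝ :=
  Matrix.diagonal a + W * Matrix.diagonal (fun i => if i ∈ Ω then 1 else 0)

/-- The sub-region `S_Ω` of the phase space. -/
def subregion {M : ℕ} (Ω : Finset (Fin M)) : Set (Fin M → ℝ) :=
  {Z | ∀ i, 0 < Z i ↔ i ∈ Ω}

/-- On `S_Ω` the piecewise-linear RNN is the affine map `Z ↦ W_Ω Z + h`. -/
theorem recurrenceMatrix_mulVec_of_mem_subregion {M : ℕ} (a h : Fin M → ℝ)
    (W : Matrix (Fin M) (Fin M) ℝ) (Ω : Finset (Fin M)) (Z : Fin M → ℝ) (hZ : Z ∈ subregion Ω) :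
    recurrenceMatrix a W Ω *ᵥ Z + h
      = Matrix.diagonal a *ᵥ Z + W *ᵥ (fun i => max (Z i) 0) + h := by
  have : Matrix.diagonal (fun i => if i ∈ Ω then (1 : ℝ) else 0) *ᵥ Z
      = fun i => max (Z i) 0 := by
    funext i
    rw [Matrix.mulVec_diagonal]
    by_cases hi : i ∈ Ω
    · simp [hi, max_eq_left ((hZ i).2 hi).le]
    · simp [hi, max_eq_right (not_lt.1 (fun hp => hi ((hZ i).1 hp)))]
  rw [recurrenceMatrix, Matrix.add_mulVec, ← Matrix.mulVec_mulVec, this]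

/-- A real matrix regarded as a complex matrix. -/
def complexify {M : ℕ} (A : Matrix (Fin M) (Fin M) ℝ) : Matrix (Fin M) (Fin M) ℂ :=
  A.map (fun x : ℝ => (x : ℂ))

/-- A complex matrix that is similar to a diagonal matrix. -/
def IsDiagonalizable {M : ℕ} (A : Matrix (Fin M) (Fin M) ℂ) : Prop :=
  ∃ (V : Matrix (Fin M) (Fin M) ℂ) (d : Fin M → ℂ),
    IsUnit V ∧ A = V * Matrix.diagonal d * V⁻¹

/-- The `k × k` Jordan block with eigenvalue `μ`. -/
def jordanBlock (k : ℕ) (μ : ℂ) : Matrix (Fin k) (Fin k) ℂ :=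
  Matrix.of fun i j => if i = j then μ else if (i : ℕ) + 1 = (j : ℕ) then 1 else 0

/-- `A` has a Jordan form consisting of `r` (non-empty) Jordan blocks, the `b`-th of which has size
`size b` and eigenvalue `ev b`. -/
def HasJordanForm {M r : ℕ} (A : Matrix (Fin M) (Fin M) ℂ) (size : Fin r → ℕ) (ev : Fin r → ℂ) :
    Prop :=
  (∀ b, 0 < size b) ∧
  ∃ (e : (Σ b : Fin r, Fin (size b)) ≃ Fin M) (P : Matrix (Fin M) (Fin M) ℂ),
    IsUnit P ∧
    A = P * Matrix.reindex e e (Matrix.blockDiagonal' fun b => jordanBlock (size b) (ev b)) * P⁻¹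

/-- In the Jordan form of `A` every `k × k` Jordan block associated with a negative real eigenvalue
occurs an even number of times. (The Jordan form exists and is unique up to the order of blocks.) -/
def EvenNegativeJordanBlocks {M : ℕ} (A : Matrix (Fin M) (Fin M) ℂ) : Prop :=
  ∃ (r : ℕ) (size : Fin r → ℕ) (ev : Fin r → ℂ), HasJordanForm A size ev ∧
    ∀ (k : ℕ) (μ : ℝ), μ < 0 → Even {b : Fin r | size b = k ∧ ev b = (μ : ℂ)}.ncard

/-- `ζ` solves the linear ODE `ζ' = B ζ + c` on `[t₀, t₁]`. -/
def SolvesODE {M : ℕ} (B : Matrix (Fin M) (Fin M) ℂ) (c : Fin M → ℂ) (t₀ t₁ : ℝ)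
    (ζ : ℝ → Fin M → ℂ) : Prop :=
  ∀ t ∈ Set.Icc t₀ t₁, HasDerivWithinAt ζ (B *ᵥ ζ t + c) (Set.Icc t₀ t₁) t

/-- The system `ζ' = B ζ + c` is equivalent on `[t₀, t₀ + Δt]` to one step of `Z ↦ A Z + h`:
for every real state `Z` it has a solution starting at `Z`, and every solution starting at `Z`
at time `t₀` is at `A Z + h` at time `t₀ + Δt`. -/
def IsEquivalentOneStep {M : ℕ} (A : Matrix (Fin M) (Fin M) ℝ) (h : Fin M → ℝ) (t₀ Δt : ℝ)
    (B : Matrix (Fin M) (Fin M) ℂ) (c : Fin M → ℂ) : Prop :=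
  ∀ Z : Fin M → ℝ,
    (∃ ζ : ℝ → Fin M → ℂ, SolvesODE B c t₀ (t₀ + Δt) ζ ∧ ζ t₀ = fun i => (Z i : ℂ)) ∧
    ∀ ζ : ℝ → Fin M → ℂ, SolvesODE B c t₀ (t₀ + Δt) ζ → (ζ t₀ = fun i => (Z i : ℂ)) →
      ζ (t₀ + Δt) = fun i => (((A *ᵥ Z + h) i : ℝ) : ℂ)

/-- The columns of `V` are a basis whose first `n` members are eigenvectors of `A` with eigenvalue
`1`. For a diagonalizable `A` whose eigenvalue `1` has multiplicity `n`, these `n` members are then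
a basis of the eigenspace. -/
def IsAdaptedBasis {M : ℕ} (A : Matrix (Fin M) (Fin M) ℂ) (n : ℕ) (V : Matrix (Fin M) (Fin M) ℂ) :
    Prop :=
  IsUnit V ∧ ∀ j : Fin M, (j : ℕ) < n → A *ᵥ V.col j = V.col j

/-- The block matrix `diag(I_n, 0)` with respect to the basis of the columns of `V`. -/
def blockIdZero {M : ℕ} (n : ℕ) (V : Matrix (Fin M) (Fin M) ℂ) : Matrix (Fin M) (Fin M) ℂ :=
  V * Matrix.diagonal (fun i : Fin M => if (i : ℕ) < n then 1 else 0) * V⁻¹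

/-- The block matrix `diag(0_n, I)` with respect to the basis of the columns of `V`. -/
def blockZeroId {M : ℕ} (n : ℕ) (V : Matrix (Fin M) (Fin M) ℂ) : Matrix (Fin M) (Fin M) ℂ :=
  V * Matrix.diagonal (fun i : Fin M => if (i : ℕ) < n then 0 else 1) * V⁻¹

/-- `ζ' = B ζ + c`, with `B = (1/Δt) L` for a logarithm `L` of `A`, is a continuous-time system
with all the properties asked for. -/
structure IsConversion {M : ℕ} (A : Matrix (Fin M) (Fin M) ℝ) (h : Fin M → ℝ) (t₀ Δt : ℝ) (n : ℕ)
    (L B : Matrix (Fin M) (Fin M) ℂ) (c : Fin M → ℂ) : Prop where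
  exp_log : NormedSpace.exp L = complexify A
  matrix_eq : B = (Δt : ℂ)⁻¹ • L
  equivalent : IsEquivalentOneStep A h t₀ Δt B c
  diagonalizable : IsDiagonalizable B
  not_invertible : ¬ IsUnit B
  zero_multiplicity : B.charpoly.rootMultiplicity 0 = n
  bias_eq : ∀ V : Matrix (Fin M) (Fin M) ℂ, IsAdaptedBasis (complexify A) n V →
    IsUnit (blockZeroId n V - complexify A) ∧
    c = -(Δt : ℂ)⁻¹ • (((blockIdZero n V + L) * (blockZeroId n V - complexify A)⁻¹) *ᵥ
      fun i => (h i : ℂ))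

end

/-! Write `A` for the recurrence matrix. Because `A = V diag(d) V⁻¹`, functions of `A` act on
eigenvalues. Let `F` be the spectral projection for the eigenvalue 1 and let `R` invert `1 - A` on
the remaining eigenvectors, so that `F + (1 - A) R = 1`. Then `h = k + (x - A x)` with `k = F h` and
`x = R h`: a drift along fixed vectors plus a part absorbed by moving the origin to `x`.

If a logarithm `L` vanishes on the 1-eigenspace and `B = L / Δt`, then `B k = 0`. The system with
bias `k / Δt - B x` has the flow `x + exp((t - t₀) B) (Z - x) + ((t - t₀) / Δt) k`, which reaches `A
Z + h` after time `Δt` (`isEquivalentOneStep_of_decomposition`). This bias is the one required: for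
each adapted basis `E_V` has the same range as `F`, the inverse of `E_V' - A` is `-F + R - E_V R`,
and multiplying by `E_V + L` leaves `-F + L R` (`block_sub_mul_eq_one`).

Everything thus reduces to logarithms vanishing on the 1-eigenspace (`isConversion_of_eigenspace`).
Any logarithm of `A` is diagonalizable (`exists_eq_conjDiag_of_exp`), and it vanishes there once its
eigenvalue 0 has multiplicity `n` (`log_mulVec_eq_zero`). The principal logarithm qualifies. For a
real one, take a conjugation-equivariant logarithm, with `log |μ|` at negative `μ`, and add `π J` on
each negative eigenspace, where `J² = -1`; such a `J` exists because the dimension is even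
(`exists_real_log`). -/

noncomputable section

/-- The matrix with eigenvalues `d` on the columns of `V`. -/
def conjDiag {M : ℕ} (V : Matrix (Fin M) (Fin M) ℂ) (d : Fin M → ℂ) : Matrix (Fin M) (Fin M) ℂ :=
  V * Matrix.diagonal d * V⁻¹

/-! ### Functional calculus of diagonalizable matrices. -/

section ConjDiag

variable {M : ℕ} {V : Matrix (Fin M) (Fin M) ℂ}

theorem conjDiag_mul (hV : IsUnit V) (d e : Fin M → ℂ) :
    conjDiag V d * conjDiag V e = conjDiag V (d * e) := by
  have h : V⁻¹ * V = 1 := Matrix.nonsing_inv_mul V ((Matrix.isUnit_iff_isUnit_det V).1 hV)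
  calc conjDiag V d * conjDiag V e
      = V * Matrix.diagonal d * (V⁻¹ * V) * Matrix.diagonal e * V⁻¹ := by
        simp only [conjDiag, Matrix.mul_assoc]
    _ = conjDiag V (d * e) := by
        rw [h, Matrix.mul_one, Matrix.mul_assoc V, Matrix.diagonal_mul_diagonal]; rfl

theorem conjDiag_one (hV : IsUnit V) : conjDiag V 1 = 1 := by
  have h : V * V⁻¹ = 1 := Matrix.mul_nonsing_inv V ((Matrix.isUnit_iff_isUnit_det V).1 hV)
  rw [conjDiag, Matrix.diagonal_one', Matrix.mul_one, h]

theorem conjDiag_add (V : Matrix (Fin M) (Fin M) ℂ) (d e : Fin M → ℂ) :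
    conjDiag V (d + e) = conjDiag V d + conjDiag V e := by
  have : Matrix.diagonal (d + e) = Matrix.diagonal d + Matrix.diagonal e :=
    (Matrix.diagonal_add d e).symm
  rw [conjDiag, this, Matrix.mul_add, Matrix.add_mul]; rfl

theorem conjDiag_smul (V : Matrix (Fin M) (Fin M) ℂ) (c : ℂ) (d : Fin M → ℂ) :
    conjDiag V (c • d) = c • conjDiag V d := by
  rw [conjDiag, Matrix.diagonal_smul, Matrix.mul_smul, Matrix.smul_mul]; rfl

theorem exp_conjDiag (hV : IsUnit V) (d : Fin M → ℂ) :
    NormedSpace.exp (conjDiag V d) = conjDiag V (fun i => Complex.exp (d i)) := by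
  rw [conjDiag, Matrix.exp_conj _ _ hV, Matrix.exp_diagonal, conjDiag]
  congr 3
  funext i
  rw [Pi.coe_exp, Complex.exp_eq_exp_ℂ]

theorem charpoly_conjDiag (hV : IsUnit V) (d : Fin M → ℂ) :
    (conjDiag V d).charpoly = ∏ i, (Polynomial.X - Polynomial.C (d i)) := by
  have h : V⁻¹ * V = 1 := Matrix.nonsing_inv_mul V ((Matrix.isUnit_iff_isUnit_det V).1 hV)
  rw [← Matrix.charpoly_diagonal, conjDiag, Matrix.charpoly_mul_comm, ← Matrix.mul_assoc, h,
    Matrix.one_mul]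

theorem rootMultiplicity_conjDiag (hV : IsUnit V) (d : Fin M → ℂ) (z : ℂ) :
    (conjDiag V d).charpoly.rootMultiplicity z = (Finset.univ.filter fun i => d i = z).card := by
  have h : ∏ i, (Polynomial.X - Polynomial.C (d i))
      = ((Finset.univ.val.map d).map fun a => Polynomial.X - Polynomial.C a).prod := by
    rw [Multiset.map_map]; rfl
  rw [charpoly_conjDiag hV, ← Polynomial.count_roots, h,
    Polynomial.roots_multiset_prod_X_sub_C, Multiset.count_map]
  simp only [eq_comm]
  rfl

theorem trace_conjDiag (hV : IsUnit V) (d : Fin M → ℂ) :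
    (conjDiag V d).trace = ∑ i, d i := by
  have h : V⁻¹ * V = 1 := Matrix.nonsing_inv_mul V ((Matrix.isUnit_iff_isUnit_det V).1 hV)
  rw [conjDiag, Matrix.trace_mul_comm, ← Matrix.mul_assoc, h, Matrix.one_mul, Matrix.trace_diagonal]

theorem conjDiag_mulVec_col (hV : IsUnit V) (d : Fin M → ℂ) (j : Fin M) :
    conjDiag V d *ᵥ V.col j = d j • V.col j := by
  have h : V⁻¹ * V = 1 := Matrix.nonsing_inv_mul V ((Matrix.isUnit_iff_isUnit_det V).1 hV)
  have : V.col j = V *ᵥ Pi.single j 1 := by simp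
  rw [this, conjDiag, Matrix.mulVec_mulVec, Matrix.mul_assoc, h, Matrix.mul_one,
    ← Matrix.mulVec_mulVec, Matrix.diagonal_mulVec_single, ← Matrix.mulVec_smul]
  congr 1
  ext i
  by_cases hi : i = j
  · subst hi; simp
  · simp [hi]

/-- An eigenvector for `z` has nonzero coordinates only at indices with `d i = z`. Hence `f` acts
correctly on every eigenvector, not only on the columns of the chosen `V`. -/
theorem conjDiag_comp_mulVec (hV : IsUnit V) (d : Fin M → ℂ) (f : ℂ → ℂ) {v : Fin M → ℂ} {z : ℂ}
    (hv : conjDiag V d *ᵥ v = z • v) : conjDiag V (f ∘ d) *ᵥ v = f z • v := by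
  have h : V⁻¹ * V = 1 := Matrix.nonsing_inv_mul V ((Matrix.isUnit_iff_isUnit_det V).1 hV)
  have h' : V * V⁻¹ = 1 := Matrix.mul_nonsing_inv V ((Matrix.isUnit_iff_isUnit_det V).1 hV)
  have key : ∀ i, d i * (V⁻¹ *ᵥ v) i = z * (V⁻¹ *ᵥ v) i := by
    intro i
    have h1 : V⁻¹ *ᵥ (conjDiag V d *ᵥ v) = Matrix.diagonal d *ᵥ (V⁻¹ *ᵥ v) := by
      rw [Matrix.mulVec_mulVec, Matrix.mulVec_mulVec, conjDiag, ← Matrix.mul_assoc,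
        ← Matrix.mul_assoc, h, Matrix.one_mul]
    rw [hv, Matrix.mulVec_smul] at h1
    have := congrFun h1 i
    rw [Matrix.mulVec_diagonal] at this
    exact this.symm
  have : Matrix.diagonal (f ∘ d) *ᵥ (V⁻¹ *ᵥ v) = f z • (V⁻¹ *ᵥ v) := by
    ext i
    rw [Matrix.mulVec_diagonal]
    by_cases hi : (V⁻¹ *ᵥ v) i = 0
    · simp [hi]
    · simp [mul_right_cancel₀ hi (key i)]
  rw [conjDiag, ← Matrix.mulVec_mulVec, ← Matrix.mulVec_mulVec, this, Matrix.mulVec_smul,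
    Matrix.mulVec_mulVec, h', Matrix.one_mulVec]

theorem ext_of_mulVec_col (hV : IsUnit V) {A B : Matrix (Fin M) (Fin M) ℂ}
    (h : ∀ j, A *ᵥ V.col j = B *ᵥ V.col j) : A = B := by
  apply hV.mul_left_injective
  ext i j
  exact congrFun (h j) i

theorem exists_complexify_eq_of_map_conj {A : Matrix (Fin M) (Fin M) ℂ}
    (h : A.map (starRingEnd ℂ) = A) : ∃ R : Matrix (Fin M) (Fin M) ℝ, A = complexify R := by
  refine ⟨A.map Complex.re, ?_⟩
  ext i j
  exact (Complex.conj_eq_iff_re.1 (congrFun (congrFun h i) j)).symm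

theorem conj_mulVec (A : Matrix (Fin M) (Fin M) ℂ) (v : Fin M → ℂ) :
    A.map (starRingEnd ℂ) *ᵥ (fun i => starRingEnd ℂ (v i))
      = fun i => starRingEnd ℂ ((A *ᵥ v) i) := by
  ext i
  exact (RingHom.map_mulVec (starRingEnd ℂ) A v i).symm

/-- A conjugation-equivariant function of a diagonalizable real matrix is real. -/
theorem exists_complexify_eq_conjDiag_comp (hV : IsUnit V) {d : Fin M → ℂ}
    {A : Matrix (Fin M) (Fin M) ℝ} (hA : complexify A = conjDiag V d) {f : ℂ → ℂ}
    (hf : ∀ z, f (starRingEnd ℂ z) = starRingEnd ℂ (f z)) :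
    ∃ R : Matrix (Fin M) (Fin M) ℝ, conjDiag V (f ∘ d) = complexify R := by
  apply exists_complexify_eq_of_map_conj
  apply ext_of_mulVec_col hV
  intro j
  -- Since `A` is real, conjugating an eigenvector gives one for the conjugate eigenvalue. It need
  -- not be a column of `V`.
  have hc : conjDiag V d *ᵥ (fun i => starRingEnd ℂ (V.col j i))
      = starRingEnd ℂ (d j) • fun i => starRingEnd ℂ (V.col j i) := by
    have h1 := conj_mulVec (conjDiag V d) (V.col j)
    have h2 : (conjDiag V d).map (starRingEnd ℂ) = conjDiag V d := by
      rw [← hA]; ext i j; simp [complexify]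
    rw [h2, conjDiag_mulVec_col hV] at h1
    rw [h1]; ext i; simp
  have h3 := conjDiag_comp_mulVec hV d f hc
  have h4 := conj_mulVec (conjDiag V (f ∘ d)) (fun i => starRingEnd ℂ (V.col j i))
  simp only [Complex.conj_conj] at h4
  rw [conjDiag_mulVec_col hV]
  refine h4.trans ?_
  rw [h3]
  ext i
  simp [hf]

end ConjDiag

/-! ### Matrix exponentials and diagonalizability of logarithms. -/

section Exp

variable {M : ℕ}

open scoped Matrix.Norms.Operator in
/-- The exponential acts affinely on vectors killed by the square of the matrix. -/
theorem exp_mulVec_of_mulVec_mulVec_eq_zero {N : Matrix (Fin M) (Fin M) ℂ} {v : Fin M → ℂ}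
    (h : N *ᵥ (N *ᵥ v) = 0) : NormedSpace.exp N *ᵥ v = v + N *ᵥ v := by
  have h1 := NormedSpace.exp_series_hasSum_exp' (𝕂 := ℂ) N
  have hc : Continuous fun B : Matrix (Fin M) (Fin M) ℂ => B *ᵥ v :=
    Continuous.matrix_mulVec continuous_id continuous_const
  have h2 := h1.map (AddMonoidHom.mk' (fun B : Matrix (Fin M) (Fin M) ℂ => B *ᵥ v)
    (fun A B => Matrix.add_mulVec A B v)) hc
  have h3 := hasSum_sum_of_ne_finset_zero (L := SummationFilter.unconditional ℕ) (s := Finset.range 2)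
    (f := fun n : ℕ => ((n.factorial : ℂ)⁻¹ • N ^ n) *ᵥ v) (by
      intro k hk
      obtain ⟨m, rfl⟩ : ∃ m, k = m + 2 := ⟨k - 2, by simp at hk; omega⟩
      rw [Matrix.smul_mulVec, pow_add, pow_two, ← Matrix.mulVec_mulVec, ← Matrix.mulVec_mulVec, h,
        Matrix.mulVec_zero, smul_zero])
  refine (h2.unique h3).trans ?_
  simp [Finset.sum_range_succ]

theorem exp_smul_one (z : ℂ) :
    NormedSpace.exp (z • (1 : Matrix (Fin M) (Fin M) ℂ)) = Complex.exp z • 1 := by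
  rw [Matrix.smul_one_eq_diagonal, Matrix.exp_diagonal, Matrix.smul_one_eq_diagonal]
  congr 1
  funext i
  rw [Pi.coe_exp, Complex.exp_eq_exp_ℂ]

/-- Split `L` into `z • 1` and the commuting remainder, whose exponential series on `v` stops after
the linear term. -/
theorem exp_mulVec_of_sub_sq {L : Matrix (Fin M) (Fin M) ℂ} {v : Fin M → ℂ} {z : ℂ}
    (h : (L - z • 1) *ᵥ ((L - z • 1) *ᵥ v) = 0) :
    NormedSpace.exp L *ᵥ v = Complex.exp z • (v + (L - z • 1) *ᵥ v) := by
  have h1 : L = z • 1 + (L - z • 1) := by abel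
  have hc : Commute (z • (1 : Matrix (Fin M) (Fin M) ℂ)) (L - z • 1) :=
    (Commute.one_left _).smul_left z
  conv_lhs => rw [h1, Matrix.exp_add_of_commute _ _ hc, exp_smul_one, ← Matrix.mulVec_mulVec,
    exp_mulVec_of_mulVec_mulVec_eq_zero h, Matrix.smul_mulVec, Matrix.one_mulVec]

theorem exp_mulVec_of_mulVec_eq_smul {L : Matrix (Fin M) (Fin M) ℂ} {v : Fin M → ℂ} {z : ℂ}
    (h : L *ᵥ v = z • v) : NormedSpace.exp L *ᵥ v = Complex.exp z • v := by
  have h0 : (L - z • 1) *ᵥ v = 0 := by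
    rw [Matrix.sub_mulVec, h, Matrix.smul_mulVec, Matrix.one_mulVec, sub_self]
  rw [exp_mulVec_of_sub_sq (z := z) (by rw [h0, Matrix.mulVec_zero]), h0, add_zero]

/-- A complex matrix without generalized eigenvectors of rank two is diagonalizable. -/
theorem exists_eq_conjDiag_of_sub_sq {L : Matrix (Fin M) (Fin M) ℂ}
    (h : ∀ (z : ℂ) (v : Fin M → ℂ), (L - z • 1) *ᵥ ((L - z • 1) *ᵥ v) = 0 →
      (L - z • 1) *ᵥ v = 0) : ∃ (V : Matrix (Fin M) (Fin M) ℂ) (d : Fin M → ℂ),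
      IsUnit V ∧ L = conjDiag V d := by
  set f : Module.End ℂ (Fin M → ℂ) := Matrix.toLin' L with hf
  have happ : ∀ (z : ℂ) v, (f - algebraMap ℂ _ z) v = (L - z • 1) *ᵥ v := by
    intro z v
    simp [hf, Matrix.sub_mulVec, Matrix.smul_mulVec]
  -- Every generalized eigenvector is an eigenvector: the exponent is lowered one step at a time by
  -- the rank-two hypothesis.
  have hgen : ∀ (z : ℂ) (k : ℕ) v, ((f - algebraMap ℂ _ z) ^ k) v = 0 →
      (f - algebraMap ℂ _ z) v = 0 := by
    intro z k
    induction k with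
    | zero => intro v hv; simp at hv; simp [hv]
    | succ k ih =>
      intro v hv
      rw [pow_succ, Module.End.mul_apply] at hv
      have := ih _ hv
      rw [happ, happ] at this
      rw [happ]
      exact h z v this
  set S : Set (Fin M → ℂ) := {v | ∃ z : ℂ, L *ᵥ v = z • v} with hS
  have hspan : ⊤ ≤ Submodule.span ℂ S := by
    rw [← Module.End.iSup_maxGenEigenspace_eq_top f]
    refine iSup_le fun z v hv => Submodule.subset_span ⟨z, ?_⟩
    rw [Module.End.mem_maxGenEigenspace] at hv
    obtain ⟨k, hk⟩ := hv
    have := hgen z k v (by simpa [Algebra.algebraMap_eq_smul_one] using hk)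
    rw [happ, Matrix.sub_mulVec, Matrix.smul_mulVec, Matrix.one_mulVec] at this
    exact sub_eq_zero.1 this
  let b0 := Module.Basis.ofSpan hspan
  have hfin := Module.Finite.finite_basis b0
  have : Fintype ((linearIndepOn_empty ℂ id).extend (Set.empty_subset S)) := Fintype.ofFinite _
  let e := Fintype.equivFinOfCardEq (n := M) (by
    rw [← Module.finrank_eq_card_basis b0]; simp)
  let b := b0.reindex e
  have hb : ∀ j, ∃ z : ℂ, L *ᵥ b j = z • b j := by
    intro j
    have : b j ∈ S := Module.Basis.ofSpan_subset hspan ⟨e.symm j, by simp [b, b0]⟩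
    exact this
  choose d hd using hb
  let V : Matrix (Fin M) (Fin M) ℂ := (Pi.basisFun ℂ (Fin M)).toMatrix b
  have hcol : ∀ j, V.col j = b j := by
    intro j; ext i; simp [V, Module.Basis.toMatrix_apply]
  have hV : IsUnit V := by
    have := (Pi.basisFun ℂ (Fin M)).invertibleToMatrix b
    exact isUnit_of_invertible _
  refine ⟨V, d, hV, ext_of_mulVec_col hV fun j => ?_⟩
  rw [conjDiag_mulVec_col hV, hcol, hd]

/-- The projection onto the `z`-eigenspace fixes `w = (A - z) v` as an eigenvector, yet kills it as
an element of the range of `A - z`; so `w = 0`. -/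
theorem conjDiag_mulVec_eq_smul_of_sub {V : Matrix (Fin M) (Fin M) ℂ} (hV : IsUnit V)
    (d : Fin M → ℂ) (z : ℂ) (v : Fin M → ℂ)
    (h : conjDiag V d *ᵥ (conjDiag V d *ᵥ v - z • v) = z • (conjDiag V d *ᵥ v - z • v)) :
    conjDiag V d *ᵥ v = z • v := by
  set w := conjDiag V d *ᵥ v - z • v with hw
  let f : ℂ → ℂ := fun x => if x = z then 1 else 0
  have h1 := conjDiag_comp_mulVec hV d f h
  have h2 : conjDiag V (f ∘ d) *ᵥ w = 0 := by
    have e1 : w = conjDiag V (d + (-z) • 1) *ᵥ v := by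
      rw [conjDiag_add, conjDiag_smul, conjDiag_one hV, Matrix.add_mulVec, Matrix.smul_mulVec,
        Matrix.one_mulVec, neg_smul, hw, sub_eq_add_neg]
    have e2 : (f ∘ d) * (d + (-z) • 1) = (0 : ℂ) • d := by
      ext i
      by_cases hi : d i = z <;> simp [f, hi]
    rw [e1, Matrix.mulVec_mulVec, conjDiag_mul hV, e2, conjDiag_smul, zero_smul, Matrix.zero_mulVec]
  rw [h2] at h1
  simp only [f, if_true, one_smul] at h1
  exact sub_eq_zero.1 h1.symm

/-- A logarithm of a diagonalizable matrix is diagonalizable. -/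
theorem exists_eq_conjDiag_of_exp {L V : Matrix (Fin M) (Fin M) ℂ} {d : Fin M → ℂ} (hV : IsUnit V)
    (h : NormedSpace.exp L = conjDiag V d) :
    ∃ (V' : Matrix (Fin M) (Fin M) ℂ) (d' : Fin M → ℂ), IsUnit V' ∧ L = conjDiag V' d' := by
  apply exists_eq_conjDiag_of_sub_sq
  intro z v hv
  have h1 := exp_mulVec_of_sub_sq hv
  have h2 : NormedSpace.exp L *ᵥ ((L - z • 1) *ᵥ v) = Complex.exp z • ((L - z • 1) *ᵥ v) := by
    apply exp_mulVec_of_mulVec_eq_smul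
    generalize (L - z • 1) *ᵥ v = w at hv
    rwa [Matrix.sub_mulVec, Matrix.smul_mulVec, Matrix.one_mulVec, sub_eq_zero] at hv
  rw [h] at h1 h2
  -- A rank-two chain for `L` at `z` would give one for `exp L` at `exp z`, the link being scaled by
  -- `exp z ≠ 0`.
  have h3 : conjDiag V d *ᵥ v - Complex.exp z • v = Complex.exp z • ((L - z • 1) *ᵥ v) := by
    rw [h1, smul_add]; abel
  have h4 := conjDiag_mulVec_eq_smul_of_sub hV d (Complex.exp z) v (by
    rw [h3, Matrix.mulVec_smul, h2])
  rw [h4, sub_self] at h3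
  exact (smul_eq_zero.1 h3.symm).resolve_left (Complex.exp_ne_zero z)

end Exp

/-! ### The explicit flow of the linear system and its uniqueness. -/

section Equivalence

variable {M : ℕ}

open scoped Matrix.Norms.Operator in
theorem hasDerivAt_exp_smul_mulVec (B : Matrix (Fin M) (Fin M) ℂ) (w : Fin M → ℂ) (t₀ t : ℝ) :
    HasDerivAt (fun s : ℝ => NormedSpace.exp ((s - t₀) • B) *ᵥ w)
      (B *ᵥ (NormedSpace.exp ((t - t₀) • B) *ᵥ w)) t := by
  have h1 : HasDerivAt (fun u : ℝ => NormedSpace.exp (u • B))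
      (B * NormedSpace.exp ((t - t₀) • B)) (t - t₀) := hasDerivAt_exp_smul_const' (𝕂 := ℝ) B (t - t₀)
  have h2 : HasDerivAt (fun s : ℝ => NormedSpace.exp ((s - t₀) • B))
      (B * NormedSpace.exp ((t - t₀) • B)) t := by
    refine (h1.scomp t ((hasDerivAt_id t).sub_const t₀)).congr_deriv ?_
    rw [one_smul]
  let φ : Matrix (Fin M) (Fin M) ℂ →ₗ[ℝ] (Fin M → ℂ) :=
    { toFun := fun C => C *ᵥ w
      map_add' := fun C D => Matrix.add_mulVec C D w
      map_smul' := fun c C => Matrix.smul_mulVec c C w }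
  have h3 := (LinearMap.toContinuousLinearMap φ).hasFDerivAt.comp_hasDerivAt t h2
  rw [Matrix.mulVec_mulVec]
  exact h3

theorem SolvesODE.eqOn {B : Matrix (Fin M) (Fin M) ℂ} {c : Fin M → ℂ} {t₀ t₁ : ℝ}
    {ζ ξ : ℝ → Fin M → ℂ} (hζ : SolvesODE B c t₀ t₁ ζ) (hξ : SolvesODE B c t₀ t₁ ξ)
    (h : ζ t₀ = ξ t₀) : Set.EqOn ζ ξ (Set.Icc t₀ t₁) := by
  let φ : (Fin M → ℂ) →L[ℝ] (Fin M → ℂ) :=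
    LinearMap.toContinuousLinearMap ((Matrix.mulVecLin B).restrictScalars ℝ)
  have hlip : LipschitzWith (‖φ‖₊ + 0) fun x : Fin M → ℂ => B *ᵥ x + c :=
    φ.lipschitz.add (LipschitzWith.const c)
  have hright : ∀ {η : ℝ → Fin M → ℂ}, SolvesODE B c t₀ t₁ η → ∀ t ∈ Set.Ico t₀ t₁,
      HasDerivWithinAt η (B *ᵥ η t + c) (Set.Ici t) t := fun hη t ht =>
    (hη t ⟨ht.1, ht.2.le⟩).mono_of_mem_nhdsWithin
      (Filter.mem_of_superset (Icc_mem_nhdsGE ht.2) (Set.Icc_subset_Icc_left ht.1))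
  exact ODE_solution_unique_of_mem_Icc_right (v := fun _ x => B *ᵥ x + c) (s := fun _ => Set.univ)
    (fun t _ => hlip.lipschitzOnWith) (fun t ht => (hζ t ht).continuousWithinAt) (hright hζ)
    (fun _ _ => trivial) (fun t ht => (hξ t ht).continuousWithinAt) (hright hξ)
    (fun _ _ => trivial) h

theorem complexify_mulVec (A : Matrix (Fin M) (Fin M) ℝ) (Z : Fin M → ℝ) :
    complexify A *ᵥ (fun i => (Z i : ℂ)) = fun i => ((A *ᵥ Z) i : ℂ) := by
  ext i
  exact (RingHom.map_mulVec Complex.ofRealHom A Z i).symm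

/-- The flow of `ζ' = B ζ + (1/Δt) k - B x`, where `B k = 0`, is explicit; its value at time
`t₀ + Δt` is affine in the initial state. -/
theorem isEquivalentOneStep_of_decomposition {A : Matrix (Fin M) (Fin M) ℝ} {h : Fin M → ℝ}
    {t₀ Δt : ℝ} (hΔt : 0 < Δt) {B : Matrix (Fin M) (Fin M) ℂ} {k x : Fin M → ℂ}
    (hexp : NormedSpace.exp (Δt • B) = complexify A) (hk : B *ᵥ k = 0)
    (hh : (fun i => (h i : ℂ)) = k + (x - complexify A *ᵥ x)) :
    IsEquivalentOneStep A h t₀ Δt B ((Δt : ℂ)⁻¹ • k - B *ᵥ x) := by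
  intro Z
  let Zc : Fin M → ℂ := fun i => (Z i : ℂ)
  -- Around the shifted origin `x` the motion is linear; the component `k` is not seen by `B` and
  -- accumulates at constant speed.
  let ξ : ℝ → Fin M → ℂ := fun t =>
    x + NormedSpace.exp ((t - t₀) • B) *ᵥ (Zc - x) + ((t - t₀) / Δt) • k
  have hξ : SolvesODE B ((Δt : ℂ)⁻¹ • k - B *ᵥ x) t₀ (t₀ + Δt) ξ := by
    intro t _
    have h1 := hasDerivAt_exp_smul_mulVec B (Zc - x) t₀ t
    have h2 : HasDerivAt (fun s : ℝ => ((s - t₀) / Δt) • k) ((1 / Δt) • k) t :=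
      (((hasDerivAt_id t).sub_const t₀).div_const Δt).smul_const k
    have h3 := ((h1.const_add x).add h2).hasDerivWithinAt (s := Set.Icc t₀ (t₀ + Δt))
    refine h3.congr_deriv ?_
    have h4 : B *ᵥ (((t - t₀) / Δt) • k) = 0 := by rw [Matrix.mulVec_smul, hk, smul_zero]
    have h5 : (1 / Δt) • k = (Δt : ℂ)⁻¹ • k := by
      ext i; simp
    simp only [ξ]
    rw [Matrix.mulVec_add, Matrix.mulVec_add, h4, h5]
    abel
  have h0 : ξ t₀ = Zc := by
    simp [ξ, NormedSpace.exp_zero]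
  have h1 : ξ (t₀ + Δt) = fun i => (((A *ᵥ Z + h) i : ℝ) : ℂ) := by
    have e1 : (fun i => (((A *ᵥ Z + h) i : ℝ) : ℂ)) = complexify A *ᵥ Zc + fun i => (h i : ℂ) := by
      rw [complexify_mulVec]; ext i; simp
    simp only [ξ]
    rw [e1, hh, add_sub_cancel_left, hexp, div_self hΔt.ne', one_smul, Matrix.mulVec_sub]
    abel
  refine ⟨⟨ξ, hξ, h0⟩, fun ζ hζ hζ0 => ?_⟩
  rw [← h1]
  exact hζ.eqOn hξ (hζ0.trans h0.symm) ⟨by linarith, le_rfl⟩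

end Equivalence

/-! ### Idempotents with equal range. -/

section Idempotent

/-- An idempotent whose range lies in that of an idempotent of the same trace has the same range. -/
theorem mul_eq_right_of_trace_eq {K : Type*} [Field K] [CharZero K] {M : ℕ}
    {E F : Matrix (Fin M) (Fin M) K} (hE : E * E = E) (hF : F * F = F) (hFE : F * E = E)
    (htr : E.trace = F.trace) : E * F = F := by
  -- The trace of an idempotent is its rank; characteristic zero turns equal traces into equal
  -- dimensions.
  have hfin : ∀ {G : Matrix (Fin M) (Fin M) K}, G * G = G →
      G.trace = (Module.finrank K (LinearMap.range (Matrix.toLin' G)) : K) := by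
    intro G hG
    have hp : LinearMap.IsProj (LinearMap.range (Matrix.toLin' G)) (Matrix.toLin' G) := by
      refine ⟨fun x => ⟨x, rfl⟩, ?_⟩
      rintro _ ⟨y, rfl⟩
      rw [← LinearMap.comp_apply, ← Matrix.toLin'_mul, hG]
    rw [← hp.trace, Matrix.trace_toLin'_eq]
  have hle : LinearMap.range (Matrix.toLin' E) ≤ LinearMap.range (Matrix.toLin' F) := by
    rintro _ ⟨y, rfl⟩
    refine ⟨Matrix.toLin' E y, ?_⟩
    rw [← LinearMap.comp_apply, ← Matrix.toLin'_mul, hFE]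
  have heq := Submodule.eq_of_le_of_finrank_eq hle (by
    have := htr
    rw [hfin hE, hfin hF] at this
    exact_mod_cast this)
  apply Matrix.toLin'.injective
  refine LinearMap.ext (fun z => ?_)
  have : ∀ z, Matrix.toLin' (E * F) z = Matrix.toLin' F z := by
    intro z
    have hz : Matrix.toLin' F z ∈ LinearMap.range (Matrix.toLin' E) := heq ▸ ⟨z, rfl⟩
    obtain ⟨u, hu⟩ := hz
    rw [Matrix.toLin'_mul, LinearMap.comp_apply, ← hu, ← LinearMap.comp_apply,
      ← Matrix.toLin'_mul, hE]
  exact this z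

end Idempotent

/-! ### The conversion theorem for logarithms vanishing on the 1-eigenspace. -/

section Conversion

variable {M : ℕ}

theorem blockIdZero_eq (n : ℕ) (V : Matrix (Fin M) (Fin M) ℂ) :
    blockIdZero n V = conjDiag V fun i => if (i : ℕ) < n then 1 else 0 := rfl

theorem blockZeroId_eq {V : Matrix (Fin M) (Fin M) ℂ} (hV : IsUnit V) (n : ℕ) :
    blockZeroId n V = 1 - blockIdZero n V := by
  rw [eq_sub_iff_add_eq, blockIdZero_eq, ← conjDiag_one hV]
  change conjDiag V _ + _ = _
  rw [← conjDiag_add]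
  congr 1
  ext i
  by_cases hi : (i : ℕ) < n <;> simp [hi]

theorem card_filter_lt {n : ℕ} (h : n ≤ M) :
    (Finset.univ.filter fun i : Fin M => (i : ℕ) < n).card = n := by
  simpa [h] using Fin.card_filter_val_lt (n := M) (m := n)

/-- With the spectral projection `F` for the eigenvalue `1` and the reduced resolvent `R`, the
inverse of `E_V' - A` is explicit. -/
theorem block_sub_mul_eq_one {E F R A : Matrix (Fin M) (Fin M) ℂ} (hEE : E * E = E)
    (hAE : A * E = E) (hEF : E * F = F) (hAF : A * F = F) (hR : F + (R - A * R) = 1) :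
    (1 - E - A) * (-F + R - E * R) = 1 := by
  have h1 : (1 - E - A) * (-F + R - E * R)
      = -F + E * F + A * F + (R - A * R) - E * R - E * R + E * E * R + A * E * R := by
    noncomm_ring
  rw [h1, hEF, hAF, hEE, hAE, ← hR]
  abel

/-- A matrix that vanishes on the eigenspace for `1` vanishes on the spectral projection. -/
theorem conjDiag_ite_mul_eq {V : Matrix (Fin M) (Fin M) ℂ} (hV : IsUnit V) {d : Fin M → ℂ}
    {L : Matrix (Fin M) (Fin M) ℂ} (hL : ∀ v, conjDiag V d *ᵥ v = v → L *ᵥ v = 0) :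
    L * conjDiag V (fun i => if d i = 1 then 1 else 0) = 0 := by
  apply ext_of_mulVec_col hV
  intro j
  rw [← Matrix.mulVec_mulVec, conjDiag_mulVec_col hV, Matrix.mulVec_smul, Matrix.zero_mulVec]
  by_cases hj : d j = 1
  · rw [hL _ (by rw [conjDiag_mulVec_col hV, hj, one_smul]), smul_zero]
  · simp [hj]

/-- Vanishing on the 1-eigenspace is the only property of the logarithm needed, so the principal,
real and arbitrary cases all pass through here. -/
theorem isConversion_of_eigenspace {A : Matrix (Fin M) (Fin M) ℝ} (h : Fin M → ℝ) (t₀ : ℝ)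
    {Δt : ℝ} (hΔt : 0 < Δt) {V : Matrix (Fin M) (Fin M) ℂ} {d : Fin M → ℂ} (hV : IsUnit V)
    (hA : complexify A = conjDiag V d) {n : ℕ}
    (hn : (Finset.univ.filter fun i => d i = 1).card = n) (hn0 : n ≠ 0)
    {L : Matrix (Fin M) (Fin M) ℂ} (hexp : NormedSpace.exp L = complexify A)
    (hL : ∀ v, complexify A *ᵥ v = v → L *ᵥ v = 0) :
    ∃ c : Fin M → ℂ, IsConversion A h t₀ Δt n L ((Δt : ℂ)⁻¹ • L) c := by
  have hnM : n ≤ M := by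
    rw [← hn]; exact (Finset.card_le_univ _).trans (by simp)
  set F := conjDiag V (fun i => if d i = 1 then 1 else 0) with hF
  -- At `d i = 1` the inverse takes the default value 0; any value would do, since `1 - d i`
  -- annihilates it in `hR`.
  set R := conjDiag V (fun i => (1 - d i)⁻¹) with hRdef
  have hΔc : (Δt : ℂ) ≠ 0 := by exact_mod_cast hΔt.ne'
  have hFF : F * F = F := by
    rw [hF, conjDiag_mul hV]; congr 1; ext i; simp
  have hAF : complexify A * F = F := by
    rw [hF, hA, conjDiag_mul hV]; congr 1; ext i
    by_cases hi : d i = 1 <;> simp [hi]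
  have hR : F + (R - complexify A * R) = 1 := by
    rw [← conjDiag_one hV, ← eq_sub_iff_add_eq', sub_eq_iff_eq_add, sub_add_eq_add_sub,
      eq_sub_iff_add_eq, hF, hRdef, hA, conjDiag_mul hV, ← conjDiag_add, ← conjDiag_add]
    congr 1; ext i
    by_cases hi : d i = 1
    · simp [hi]
    · have : 1 - d i ≠ 0 := sub_ne_zero.2 (Ne.symm hi)
      simp only [Pi.add_apply, Pi.mul_apply, Pi.one_apply, hi, if_false]
      field_simp
      ring
  have hLF : L * F = 0 := conjDiag_ite_mul_eq hV (fun v hv => hL v (by rwa [hA]))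
  have hLsol : ∀ W : Matrix (Fin M) (Fin M) ℂ, complexify A * W = W → L * W = 0 := by
    intro W hW
    ext i j
    have := hL (W.col j) (by ext i; exact congrFun (congrFun hW i) j)
    exact congrFun this i
  set hc : Fin M → ℂ := fun i => (h i : ℂ) with hhc
  set k := F *ᵥ hc with hk
  set x := R *ᵥ hc with hx
  obtain ⟨V', d', hV', hLd⟩ := exists_eq_conjDiag_of_exp hV (hexp.trans hA)
  have hBd : (Δt : ℂ)⁻¹ • L = conjDiag V' ((Δt : ℂ)⁻¹ • d') := by rw [conjDiag_smul, ← hLd]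
  -- The eigenvalues of `L` with exponential 1 number `n`, and all of them are 0 because `L` kills
  -- their eigenvectors.
  have hcard : (Finset.univ.filter fun i => d' i = 0).card = n := by
    have h1 : (Finset.univ.filter fun i => Complex.exp (d' i) = 1).card = n := by
      rw [← hn, ← rootMultiplicity_conjDiag hV', ← rootMultiplicity_conjDiag hV, ← exp_conjDiag hV',
        ← hLd, hexp, hA]
    rw [← h1]
    congr 1
    ext i
    simp only [Finset.mem_filter, Finset.mem_univ, true_and]
    constructor
    · intro hi; rw [hi, Complex.exp_zero]
    · intro hi
      have h2 : complexify A *ᵥ V'.col i = V'.col i := by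
        rw [← hexp, hLd, exp_conjDiag hV', conjDiag_mulVec_col hV', hi, one_smul]
      have h3 := hL _ h2
      rw [hLd, conjDiag_mulVec_col hV'] at h3
      refine (smul_eq_zero.1 h3).resolve_right fun h4 => ?_
      have h5 : V' *ᵥ Pi.single i 1 = V' *ᵥ 0 := by simpa using h4
      have := congrFun (Matrix.mulVec_injective_of_isUnit hV' h5) i
      simp at this
  have hmult : ((Δt : ℂ)⁻¹ • L).charpoly.rootMultiplicity 0 = n := by
    rw [hBd, rootMultiplicity_conjDiag hV', ← hcard]
    congr 1
    ext i
    simp [hΔt.ne']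
  refine ⟨(Δt : ℂ)⁻¹ • k - ((Δt : ℂ)⁻¹ • L) *ᵥ x, hexp, rfl, ?_, ⟨V', _, hV', hBd⟩, ?_, hmult, ?_⟩
  · apply isEquivalentOneStep_of_decomposition hΔt
    · have : Δt • ((Δt : ℂ)⁻¹ • L) = L := by
        ext i j; simp [hΔc]
      rw [this, hexp]
    · rw [hk, Matrix.mulVec_mulVec, Matrix.smul_mul, hLF, smul_zero, Matrix.zero_mulVec]
    · rw [hk, hx, Matrix.mulVec_mulVec, ← Matrix.sub_mulVec, ← Matrix.add_mulVec, hR,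
        Matrix.one_mulVec]
  · intro hu
    have hdet := (Matrix.isUnit_iff_isUnit_det _).1 hu
    obtain ⟨i, hi⟩ : ∃ i, d' i = 0 := by
      have : (Finset.univ.filter fun i => d' i = 0).Nonempty := by
        rw [← Finset.card_pos, hcard]; omega
      obtain ⟨i, hi⟩ := this
      exact ⟨i, (Finset.mem_filter.1 hi).2⟩
    rw [hBd, conjDiag, Matrix.det_mul, Matrix.det_mul, Matrix.det_diagonal,
      Finset.prod_eq_zero (Finset.mem_univ i) (by simp [hi])] at hdet
    simp at hdet
  · rintro U ⟨hU, hcol⟩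
    -- Only the first `n` columns of `U` are constrained, so `E` may differ from `F` in its kernel;
    -- only the ranges agree.
    set E := blockIdZero n U with hE
    have hEE : E * E = E := by
      rw [hE, blockIdZero_eq, conjDiag_mul hU]; congr 1; ext i; simp
    have hAE : complexify A * E = E := by
      apply ext_of_mulVec_col hU
      intro j
      rw [← Matrix.mulVec_mulVec, hE, blockIdZero_eq, conjDiag_mulVec_col hU, Matrix.mulVec_smul]
      by_cases hj : (j : ℕ) < n
      · rw [hcol j hj]
      · simp [hj]
    have hFE : F * E = E := by
      have h1 : F * E + (R * E - R * E) = E := by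
        have h2 : R * complexify A = complexify A * R := by
          rw [hRdef, hA, conjDiag_mul hV, conjDiag_mul hV, mul_comm]
        have h3 : (F + (R - complexify A * R)) * E = E := by rw [hR, Matrix.one_mul]
        rw [← h2, Matrix.add_mul, Matrix.sub_mul, Matrix.mul_assoc R, hAE] at h3
        exact h3
      simpa using h1
    have hEF : E * F = F := by
      apply mul_eq_right_of_trace_eq hEE hFF hFE
      rw [hE, blockIdZero_eq, hF, trace_conjDiag hU, trace_conjDiag hV, Finset.sum_boole,
        Finset.sum_boole, hn, card_filter_lt hnM]
    have hLE : L * E = 0 := hLsol E hAE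
    have hinv := block_sub_mul_eq_one hEE hAE hEF hAF hR
    rw [blockZeroId_eq hU, ← hE]
    refine ⟨IsUnit.of_mul_eq_one _ hinv, ?_⟩
    rw [Matrix.inv_eq_right_inv hinv]
    have h1 : (E + L) * (-F + R - E * R)
        = -(E * F) - L * F + E * R - E * E * R + L * R - L * E * R := by noncomm_ring
    rw [h1, hEF, hLF, hEE, hLE, hk, hx, Matrix.mulVec_mulVec, Matrix.smul_mul, Matrix.smul_mulVec,
      ← smul_sub, ← Matrix.sub_mulVec, neg_smul, ← smul_neg, ← Matrix.neg_mulVec]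
    congr 2
    simp only [Matrix.zero_mul]
    abel

/-- A logarithm whose eigenvalue `0` has the multiplicity of the eigenvalue `1` of its exponential
vanishes on the eigenspace for `1`. -/
theorem log_mulVec_eq_zero {A L V : Matrix (Fin M) (Fin M) ℂ} {d : Fin M → ℂ} (hV : IsUnit V)
    (hA : A = conjDiag V d) (hexp : NormedSpace.exp L = A)
    (hL : L.charpoly.rootMultiplicity 0 = (Finset.univ.filter fun i => d i = 1).card) {v : Fin M → ℂ}
    (hv : A *ᵥ v = v) : L *ᵥ v = 0 := by
  obtain ⟨V', d', hV', hLd⟩ := exists_eq_conjDiag_of_exp hV (hexp.trans hA)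
  have hAd : A = conjDiag V' (fun i => Complex.exp (d' i)) := by
    rw [← hexp, hLd, exp_conjDiag hV']
  have h1 : (Finset.univ.filter fun i => Complex.exp (d' i) = 1).card
      = (Finset.univ.filter fun i => d i = 1).card := by
    rw [← rootMultiplicity_conjDiag hV', ← rootMultiplicity_conjDiag hV, ← hAd, hA]
  have hsub : (Finset.univ.filter fun i => d' i = 0)
      ⊆ Finset.univ.filter fun i => Complex.exp (d' i) = 1 := by
    intro i hi
    simp only [Finset.mem_filter, Finset.mem_univ, true_and] at hi ⊢
    rw [hi, Complex.exp_zero]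
  -- Equal counts exclude nonzero eigenvalues in `2πiℤ`.
  have heq := Finset.eq_of_subset_of_card_le hsub (by
    rw [h1, ← hL, hLd, rootMultiplicity_conjDiag hV'])
  have h2 := conjDiag_comp_mulVec hV' (fun i => Complex.exp (d' i))
    (fun z => if z = 1 then 1 else 0) (v := v) (z := 1) (by rw [← hAd, hv, one_smul])
  simp only [if_true, one_smul] at h2
  rw [← h2, Matrix.mulVec_mulVec, hLd, conjDiag_mul hV']
  have h3 : (d' * ((fun z : ℂ => if z = 1 then (1 : ℂ) else 0) ∘ fun i => Complex.exp (d' i)))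
      = (0 : ℂ) • d' := by
    ext i
    by_cases hi : Complex.exp (d' i) = 1
    · have : i ∈ Finset.univ.filter fun i => d' i = 0 := by rw [heq]; simp [hi]
      simp [(Finset.mem_filter.1 this).2]
    · simp [hi]
  rw [h3, conjDiag_smul, zero_smul, Matrix.zero_mulVec]

/-- The principal logarithm works because `log 1 = 0`. -/
theorem exists_log_mulVec_eq_zero {V : Matrix (Fin M) (Fin M) ℂ} {d : Fin M → ℂ} (hV : IsUnit V)
    (hd : ∀ i, d i ≠ 0) : ∃ L, NormedSpace.exp L = conjDiag V d ∧
      ∀ v, conjDiag V d *ᵥ v = v → L *ᵥ v = 0 := by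
  refine ⟨conjDiag V (Complex.log ∘ d), ?_, fun v hv => ?_⟩
  · rw [exp_conjDiag hV]; congr 1; ext i; exact Complex.exp_log (hd i)
  · rw [conjDiag_comp_mulVec hV d Complex.log (z := 1) (by rw [hv, one_smul]), Complex.log_one,
      zero_smul]

/-- The columns of a diagonalizing matrix can be permuted so that the eigenvectors for the
eigenvalue `1` come first. -/
theorem exists_isAdaptedBasis {V : Matrix (Fin M) (Fin M) ℂ} {d : Fin M → ℂ} (hV : IsUnit V) :
    ∃ (V' : Matrix (Fin M) (Fin M) ℂ) (d' : Fin M → ℂ),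
      IsAdaptedBasis (conjDiag V d) (Finset.univ.filter fun i => d i = 1).card V' ∧
      conjDiag V d = V' * Matrix.diagonal d' * V'⁻¹ := by
  set n := (Finset.univ.filter fun i => d i = 1).card with hn
  have hnM : n ≤ M := (Finset.card_le_univ _).trans (by simp)
  obtain ⟨σ, hσ⟩ : ∃ σ : Equiv.Perm (Fin M), ∀ i : Fin M, (i : ℕ) < n → d (σ i) = 1 := by
    have hc : Fintype.card {i : Fin M // (i : ℕ) < n} = Fintype.card {i : Fin M // d i = 1} := by
      rw [Fintype.card_subtype, Fintype.card_subtype, card_filter_lt hnM]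
    let e := Fintype.equivOfCardEq hc
    exact ⟨e.extendSubtype, fun i hi => e.extendSubtype_mem i hi⟩
  have hV' : IsUnit (V.submatrix id σ) := by
    rw [Matrix.isUnit_iff_isUnit_det, Matrix.det_permute']
    exact ((Units.isUnit _).map (Int.castRingHom ℂ)).mul ((Matrix.isUnit_iff_isUnit_det V).1 hV)
  refine ⟨V.submatrix id σ, d ∘ σ, ⟨hV', fun j hj => ?_⟩, ?_⟩
  · have := conjDiag_mulVec_col hV d (σ j)
    rw [hσ j hj, one_smul] at this
    exact this
  · apply ext_of_mulVec_col hV'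
    intro j
    have h1 := conjDiag_mulVec_col hV' (d ∘ σ) j
    have h2 := conjDiag_mulVec_col hV d (σ j)
    exact h2.trans h1.symm

end Conversion

/-! ### From Jordan blocks to eigenvalue multiplicities. -/

section JordanForm

theorem charpoly_jordanBlock (k : ℕ) (z : ℂ) :
    (jordanBlock k z).charpoly = (Polynomial.X - Polynomial.C z) ^ k := by
  rw [Matrix.charpoly_of_isUpperTriangular]
  · simp [jordanBlock]
  · intro i j hij
    have h1 : j < i := hij
    have h2 : i ≠ j := h1.ne'
    have h3 : ¬ (i : ℕ) + 1 = j := by have : (j : ℕ) < i := h1; omega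
    simp [jordanBlock, h2, h3]

theorem charpoly_blockDiagonal' {r : ℕ} {size : Fin r → ℕ}
    (J : ∀ b, Matrix (Fin (size b)) (Fin (size b)) ℂ) :
    (Matrix.blockDiagonal' J).charpoly = ∏ b, (J b).charpoly := by
  have h : (Matrix.blockDiagonal' J).charmatrix
      = Matrix.blockDiagonal' fun b => (J b).charmatrix := by
    ext ⟨a, i⟩ ⟨b, j⟩ : 2
    by_cases hab : a = b
    · subst hab
      rw [Matrix.blockDiagonal'_apply_eq]
      by_cases hij : i = j
      · subst hij
        rw [Matrix.charmatrix_apply_eq, Matrix.charmatrix_apply_eq, Matrix.blockDiagonal'_apply_eq]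
      · rw [Matrix.charmatrix_apply_ne _ _ _ hij, Matrix.charmatrix_apply_ne _ _ _ (by simpa using hij),
          Matrix.blockDiagonal'_apply_eq]
    · rw [Matrix.blockDiagonal'_apply_ne _ _ _ hab,
        Matrix.charmatrix_apply_ne _ _ _ (by simp [hab]), Matrix.blockDiagonal'_apply_ne _ _ _ hab]
      simp
  rw [Matrix.charpoly, h, (Matrix.blockTriangular_blockDiagonal' _).det_fintype]
  refine Finset.prod_congr rfl fun b _ => ?_
  rw [Matrix.charpoly]
  refine Eq.trans ?_ (Matrix.det_submatrix_equiv_self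
    (Equiv.sigmaSubtype (β := fun b => Fin (size b)) b) (J b).charmatrix)
  congr 1
  ext ⟨⟨a, i⟩, ha⟩ ⟨⟨c, j⟩, hc⟩ : 2
  dsimp only at ha hc
  subst ha
  subst hc
  simp [Matrix.toSquareBlock_def]

theorem HasJordanForm.rootMultiplicity_charpoly {M r : ℕ} {A : Matrix (Fin M) (Fin M) ℂ}
    {size : Fin r → ℕ} {ev : Fin r → ℂ} (h : HasJordanForm A size ev) (z : ℂ) :
    A.charpoly.rootMultiplicity z = ∑ b with ev b = z, size b := by
  obtain ⟨-, e, P, hP, hA⟩ := h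
  have hPP : P⁻¹ * P = 1 := Matrix.nonsing_inv_mul P ((Matrix.isUnit_iff_isUnit_det P).1 hP)
  rw [hA, Matrix.charpoly_mul_comm, ← Matrix.mul_assoc, hPP, Matrix.one_mul,
    Matrix.charpoly_reindex, charpoly_blockDiagonal']
  simp only [charpoly_jordanBlock]
  rw [← Polynomial.count_roots, Polynomial.roots_prod _ _
    (Finset.prod_ne_zero_iff.2 fun b _ => pow_ne_zero _ (Polynomial.X_sub_C_ne_zero _)),
    Multiset.count_bind, Finset.sum_filter]
  change ∑ b, _ = _
  refine Finset.sum_congr rfl fun b _ => ?_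
  rw [Polynomial.roots_pow, Polynomial.roots_X_sub_C, Multiset.count_nsmul,
    Multiset.count_singleton]
  by_cases hb : ev b = z
  · simp [hb]
  · simp [hb, Ne.symm hb]

/-- Grouped by size `k`, the blocks for `μ` contribute `k` times an even number to the multiplicity.
This parity is all that the real logarithm needs. -/
theorem EvenNegativeJordanBlocks.even_rootMultiplicity {M : ℕ} {A : Matrix (Fin M) (Fin M) ℂ}
    (h : EvenNegativeJordanBlocks A) {μ : ℝ} (hμ : μ < 0) :
    Even (A.charpoly.rootMultiplicity (μ : ℂ)) := by
  obtain ⟨r, size, ev, hJ, heven⟩ := h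
  rw [hJ.rootMultiplicity_charpoly, ← Finset.sum_fiberwise_of_maps_to'
    (t := Finset.univ.image size) (fun i _ => Finset.mem_image_of_mem size (Finset.mem_univ i))
    (fun k => k), even_iff_two_dvd]
  refine Finset.dvd_sum fun k _ => ?_
  rw [Finset.sum_const, smul_eq_mul, Finset.filter_filter]
  refine Dvd.dvd.mul_right (even_iff_two_dvd.1 ?_) _
  have hset : {b : Fin r | size b = k ∧ ev b = (μ : ℂ)}
      = ((Finset.univ.filter fun b => ev b = μ ∧ size b = k : Finset (Fin r)) : Set (Fin r)) := by
    ext b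
    simp [and_comm]
  have := heven k μ hμ
  rwa [hset, Set.ncard_coe_finset] at this

end JordanForm

/-! ### Real logarithms from complex structures on negative eigenspaces. -/

section RealLogarithm

variable {M : ℕ}

/-- An idempotent real matrix of even rank carries a complex structure on its range. -/
theorem exists_complex_structure {Q : Matrix (Fin M) (Fin M) ℝ} (hQ : Q * Q = Q) {m : ℕ}
    (hm : Even m) (htr : Q.trace = m) :
    ∃ J : Matrix (Fin M) (Fin M) ℝ, J * J = -Q ∧ Q * J = J ∧ J * Q = J := by
  set q := Matrix.toLin' Q with hq
  have hqq : ∀ x, q (q x) = q x := by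
    intro x
    rw [hq, ← LinearMap.comp_apply, ← Matrix.toLin'_mul, hQ]
  have hp : LinearMap.IsProj (LinearMap.range q) q :=
    ⟨fun x => ⟨x, rfl⟩, by rintro _ ⟨y, rfl⟩; exact hqq y⟩
  have hrank : Module.finrank ℝ (LinearMap.range q) = m := by
    have := hp.trace
    rw [hq, Matrix.trace_toLin'_eq, htr] at this
    exact_mod_cast this.symm
  obtain ⟨k, rfl⟩ := hm
  have hfin : Module.finrank ℝ (LinearMap.range q) = Module.finrank ℝ (Fin k → ℂ) := by
    rw [hrank, Module.finrank_pi_fintype]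
    simp [Complex.finrank_real_complex, mul_two]
  -- The range has even dimension `k + k`, so it is identified with `ℂᵏ` and multiplication by `i`
  -- is transported to it.
  let e := LinearEquiv.ofFinrankEq _ _ hfin
  let I : (Fin k → ℂ) →ₗ[ℝ] (Fin k → ℂ) :=
    (LinearMap.lsmul ℂ (Fin k → ℂ) Complex.I).restrictScalars ℝ
  have hI : ∀ y, I (I y) = -y := by
    intro y
    change Complex.I • Complex.I • y = -y
    rw [smul_smul, Complex.I_mul_I, neg_one_smul]
  let j : (Fin M → ℝ) →ₗ[ℝ] (Fin M → ℝ) :=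
    (LinearMap.range q).subtype ∘ₗ e.symm.toLinearMap ∘ₗ I ∘ₗ e.toLinearMap ∘ₗ q.rangeRestrict
  have hj : ∀ x, j x = (e.symm (I (e (q.rangeRestrict x))) : Fin M → ℝ) := fun _ => rfl
  have hrr : ∀ y : LinearMap.range q, q.rangeRestrict (y : Fin M → ℝ) = y := by
    rintro ⟨_, ⟨y, rfl⟩⟩
    exact Subtype.ext (hqq y)
  have hjj : ∀ x, j (j x) = -(q x) := by
    intro x
    rw [hj, hj, hrr, LinearEquiv.apply_symm_apply, hI, map_neg, LinearEquiv.symm_apply_apply]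
    rfl
  have hqj : ∀ x, q (j x) = j x := by
    intro x
    rw [hj]
    exact congrArg Subtype.val (hrr _)
  have hjq : ∀ x, j (q x) = j x := by
    intro x
    rw [hj, hj]
    congr 4
    exact Subtype.ext (hqq x)
  refine ⟨LinearMap.toMatrix' j, ?_, ?_, ?_⟩ <;> apply Matrix.toLin'.injective <;>
    refine LinearMap.ext fun x => ?_
  · rw [Matrix.toLin'_mul, Matrix.toLin'_toMatrix', LinearMap.comp_apply, hjj, map_neg]; rfl
  · rw [Matrix.toLin'_mul, Matrix.toLin'_toMatrix', LinearMap.comp_apply, ← hq, hqj]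
  · rw [Matrix.toLin'_mul, Matrix.toLin'_toMatrix', LinearMap.comp_apply, ← hq, hjq]

theorem complexify_mul (A B : Matrix (Fin M) (Fin M) ℝ) :
    complexify (A * B) = complexify A * complexify B :=
  Matrix.map_mul (f := Complex.ofRealHom)

theorem complexify_injective : Function.Injective (complexify (M := M)) := by
  intro A B h
  ext i j
  exact Complex.ofReal_injective (congrFun (congrFun h i) j)

/-- The logarithm on `ℂ`, made conjugation-equivariant by dropping the imaginary part on the
negative real axis. -/
def equivariantLog (z : ℂ) : ℂ := if z.im = 0 then (Real.log z.re : ℂ) else Complex.log z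

theorem equivariantLog_conj (z : ℂ) :
    equivariantLog (starRingEnd ℂ z) = starRingEnd ℂ (equivariantLog z) := by
  by_cases h : z.im = 0
  · simp [equivariantLog, h]
  · have : z.arg ≠ Real.pi := fun h' => h (Complex.arg_eq_pi_iff.1 h').2
    simp [equivariantLog, h, Complex.log_conj _ this]

theorem exp_equivariantLog {z : ℂ} (h0 : z ≠ 0) (h : ∀ μ : ℝ, μ < 0 → z ≠ μ) :
    Complex.exp (equivariantLog z) = z := by
  by_cases hz : z.im = 0
  · have hre : z = (z.re : ℂ) := Complex.ext (by simp) (by simp [hz])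
    have hpos : 0 < z.re := by
      rcases lt_trichotomy z.re 0 with h1 | h1 | h1
      · exact absurd hre (h _ h1)
      · rw [h1] at hre; exact absurd hre (by simpa using h0)
      · exact h1
    rw [equivariantLog, if_pos hz, ← Complex.ofReal_exp, Real.exp_log hpos, ← hre]
  · rw [equivariantLog, if_neg hz, Complex.exp_log h0]

theorem equivariantLog_one : equivariantLog 1 = 0 := by simp [equivariantLog]

theorem exp_equivariantLog_of_neg {μ : ℝ} (hμ : μ < 0) :
    Complex.exp (equivariantLog μ) = -μ := by
  rw [equivariantLog, if_pos (by simp), Complex.ofReal_re, ← Complex.ofReal_exp,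
    Real.exp_log_of_neg hμ, Complex.ofReal_neg]

/-- A complex structure on an eigenspace adds `± i π` to the logarithm. -/
theorem exp_mulVec_of_complex_structure {L J : Matrix (Fin M) (Fin M) ℂ} {ℓ : ℂ}
    {v : Fin M → ℂ} (h1 : L *ᵥ v = ℓ • v + (Real.pi : ℂ) • (J *ᵥ v))
    (h2 : L *ᵥ (J *ᵥ v) = ℓ • (J *ᵥ v) - (Real.pi : ℂ) • v) :
    NormedSpace.exp L *ᵥ v = -Complex.exp ℓ • v := by
  -- The vectors `v ∓ i J v` are sent by `L` to their multiples by `ℓ ± iπ`; both exponentials equal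
  -- `-exp ℓ`, and `v` is the mean of the two.
  have hp : L *ᵥ (v - Complex.I • (J *ᵥ v))
      = (ℓ + Real.pi * Complex.I) • (v - Complex.I • (J *ᵥ v)) := by
    rw [Matrix.mulVec_sub, Matrix.mulVec_smul, h1, h2]
    ext i
    simp only [Pi.sub_apply, Pi.add_apply, Pi.smul_apply, smul_eq_mul]
    linear_combination (Real.pi * (J *ᵥ v) i) * Complex.I_sq
  have hm : L *ᵥ (v + Complex.I • (J *ᵥ v))
      = (ℓ - Real.pi * Complex.I) • (v + Complex.I • (J *ᵥ v)) := by
    rw [Matrix.mulVec_add, Matrix.mulVec_smul, h1, h2]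
    ext i
    simp only [Pi.sub_apply, Pi.add_apply, Pi.smul_apply, smul_eq_mul]
    linear_combination (Real.pi * (J *ᵥ v) i) * Complex.I_sq
  have ep := exp_mulVec_of_mulVec_eq_smul hp
  have em := exp_mulVec_of_mulVec_eq_smul hm
  rw [Complex.exp_add, Complex.exp_pi_mul_I] at ep
  rw [Complex.exp_sub, Complex.exp_pi_mul_I] at em
  have hv : v = (2⁻¹ : ℂ) • ((v - Complex.I • (J *ᵥ v)) + (v + Complex.I • (J *ᵥ v))) := by
    ext i; simp only [Pi.sub_apply, Pi.add_apply, Pi.smul_apply, smul_eq_mul]; ring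
  conv_lhs => rw [hv, Matrix.mulVec_smul, Matrix.mulVec_add, ep, em]
  ext i
  simp only [Pi.sub_apply, Pi.add_apply, Pi.smul_apply, smul_eq_mul]
  ring

/-- For each negative eigenvalue, a complex structure on the real eigenspace. -/
theorem exists_eigenspace_complex_structure {A : Matrix (Fin M) (Fin M) ℝ}
    {V : Matrix (Fin M) (Fin M) ℂ} {d : Fin M → ℂ} (hV : IsUnit V)
    (hA : complexify A = conjDiag V d) {μ : ℝ}
    (heven : Even (Finset.univ.filter fun i => d i = μ).card) :
    ∃ J : Matrix (Fin M) (Fin M) ℝ,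
      (∀ v : Fin M → ℂ, complexify A *ᵥ v = (μ : ℂ) • v →
        complexify J *ᵥ (complexify J *ᵥ v) = -v) ∧
      (∀ v : Fin M → ℂ, complexify A *ᵥ (complexify J *ᵥ v) = (μ : ℂ) • (complexify J *ᵥ v)) ∧
      ∀ (z : ℂ) (v : Fin M → ℂ), z ≠ μ → complexify A *ᵥ v = z • v → complexify J *ᵥ v = 0 := by
  let f : ℂ → ℂ := fun z => if z = μ then 1 else 0
  have hf : ∀ z, f (starRingEnd ℂ z) = starRingEnd ℂ (f z) := by
    intro z
    have : starRingEnd ℂ z = μ ↔ z = μ := by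
      rw [← Complex.conj_ofReal μ, (starRingEnd ℂ).injective.eq_iff, Complex.conj_ofReal]
    by_cases hz : z = μ
    · simp [f, hz]
    · simp [f, hz, this]
  obtain ⟨Q, hQ⟩ := exists_complexify_eq_conjDiag_comp hV hA hf
  have hQQ : Q * Q = Q := by
    apply complexify_injective
    rw [complexify_mul, ← hQ, conjDiag_mul hV]
    congr 1; ext i; simp [f]
  have htr : Q.trace = ((Finset.univ.filter fun i => d i = μ).card : ℝ) := by
    have h1 := trace_conjDiag hV (f ∘ d)
    rw [hQ] at h1
    have h2 : (complexify Q).trace = (Q.trace : ℂ) := by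
      simp [Matrix.trace, complexify]
    rw [h2] at h1
    simp only [f, Function.comp_apply, Finset.sum_boole] at h1
    exact_mod_cast h1
  obtain ⟨J, hJJ, hQJ, hJQ⟩ := exists_complex_structure hQQ heven htr
  have cJJ : complexify J * complexify J = -complexify Q := by
    rw [← complexify_mul, hJJ]; ext i j; simp [complexify]
  have cQJ : complexify Q * complexify J = complexify J := by rw [← complexify_mul, hQJ]
  have cJQ : complexify J * complexify Q = complexify J := by rw [← complexify_mul, hJQ]
  have cAQ : complexify A * complexify Q = (μ : ℂ) • complexify Q := by
    rw [← hQ, hA, conjDiag_mul hV, ← conjDiag_smul]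
    congr 1; ext i
    by_cases hi : d i = μ <;> simp [f, hi]
  have hfun : ∀ (z : ℂ) (v : Fin M → ℂ), complexify A *ᵥ v = z • v →
      complexify Q *ᵥ v = f z • v := by
    intro z v hv
    rw [← hQ]
    exact conjDiag_comp_mulVec hV d f (hA ▸ hv)
  refine ⟨J, fun v hv => ?_, fun v => ?_, fun z v hz hv => ?_⟩
  · rw [Matrix.mulVec_mulVec, cJJ, Matrix.neg_mulVec, hfun _ v hv]
    simp [f]
  · rw [← cQJ, Matrix.mulVec_mulVec, ← Matrix.mul_assoc, cAQ, Matrix.smul_mul, Matrix.smul_mulVec]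
  · rw [← cJQ, ← Matrix.mulVec_mulVec, hfun z v hv]
    simp [f, hz]

/-- A diagonalizable invertible real matrix whose negative eigenvalues have even multiplicities has
a real logarithm that vanishes on the eigenspace for `1`. -/
theorem exists_real_log {A : Matrix (Fin M) (Fin M) ℝ}
    {V : Matrix (Fin M) (Fin M) ℂ} {d : Fin M → ℂ} (hV : IsUnit V)
    (hA : complexify A = conjDiag V d) (hd : ∀ i, d i ≠ 0)
    (heven : ∀ μ : ℝ, μ < 0 → Even (Finset.univ.filter fun i => d i = μ).card) :
    ∃ S : Matrix (Fin M) (Fin M) ℝ, NormedSpace.exp (complexify S) = complexify A ∧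
      ∀ v, complexify A *ᵥ v = v → complexify S *ᵥ v = 0 := by
  obtain ⟨G, hG⟩ := exists_complexify_eq_conjDiag_comp hV hA equivariantLog_conj
  have hGv : ∀ (z : ℂ) (v : Fin M → ℂ), complexify A *ᵥ v = z • v →
      complexify G *ᵥ v = equivariantLog z • v := by
    intro z v hv
    rw [← hG]
    exact conjDiag_comp_mulVec hV d _ (hA ▸ hv)
  have hex : ∀ μ : ℝ, ∃ J : Matrix (Fin M) (Fin M) ℝ, μ < 0 →
      (∀ v : Fin M → ℂ, complexify A *ᵥ v = (μ : ℂ) • v →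
        complexify J *ᵥ (complexify J *ᵥ v) = -v) ∧
      (∀ v : Fin M → ℂ, complexify A *ᵥ (complexify J *ᵥ v) = (μ : ℂ) • (complexify J *ᵥ v)) ∧
      ∀ (z : ℂ) (v : Fin M → ℂ), z ≠ μ → complexify A *ᵥ v = z • v → complexify J *ᵥ v = 0 := by
    intro μ
    by_cases hμ : μ < 0
    · obtain ⟨J, hJ⟩ := exists_eigenspace_complex_structure hV hA (heven μ hμ)
      exact ⟨J, fun _ => hJ⟩
    · exact ⟨0, fun h => absurd h hμ⟩
  choose J hJ using hex
  -- Real parts of nonreal eigenvalues may enter `N`. If such a number is not itself an eigenvalue,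
  -- its `J μ` kills every eigenvector, so it does no harm.
  let N : Finset ℝ := (Finset.univ.image fun i => (d i).re).filter (· < 0)
  have hNneg : ∀ μ ∈ N, μ < 0 := fun μ hμ => (Finset.mem_filter.1 hμ).2
  let S : Matrix (Fin M) (Fin M) ℝ := G + Real.pi • ∑ μ ∈ N, J μ
  have hS : ∀ v, complexify S *ᵥ v
      = complexify G *ᵥ v + (Real.pi : ℂ) • ∑ μ ∈ N, complexify (J μ) *ᵥ v := by
    intro v
    have : complexify S = complexify G + (Real.pi : ℂ) • ∑ μ ∈ N, complexify (J μ) := by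
      ext i j
      simp [S, complexify, Matrix.sum_apply]
    rw [this, Matrix.add_mulVec, Matrix.smul_mulVec, Matrix.sum_mulVec]
  have hS0 : ∀ (z : ℂ) (v : Fin M → ℂ), (∀ μ : ℝ, μ < 0 → z ≠ μ) → complexify A *ᵥ v = z • v →
      complexify S *ᵥ v = equivariantLog z • v := by
    intro z v hz hv
    rw [hS, hGv z v hv, Finset.sum_eq_zero, smul_zero, add_zero]
    intro μ hμ
    exact (hJ μ (hNneg μ hμ)).2.2 z v (hz μ (hNneg μ hμ)) hv
  have hS1 : ∀ μ ∈ N, ∀ v : Fin M → ℂ, complexify A *ᵥ v = (μ : ℂ) • v →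
      complexify S *ᵥ v = equivariantLog μ • v + (Real.pi : ℂ) • (complexify (J μ) *ᵥ v) := by
    intro μ hμ v hv
    rw [hS, hGv _ v hv, Finset.sum_eq_single_of_mem μ hμ]
    intro ν hν hne
    exact (hJ ν (hNneg ν hν)).2.2 μ v (by exact_mod_cast hne.symm) hv
  refine ⟨S, ?_, fun v hv => ?_⟩
  · apply ext_of_mulVec_col hV
    intro j
    have hcol : complexify A *ᵥ V.col j = d j • V.col j := by rw [hA, conjDiag_mulVec_col hV]
    rw [hcol]
    by_cases hneg : ∃ μ : ℝ, μ < 0 ∧ d j = μ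
    · obtain ⟨μ, hμ, hdj⟩ := hneg
      have hμN : μ ∈ N := by
        refine Finset.mem_filter.2 ⟨Finset.mem_image.2 ⟨j, Finset.mem_univ _, ?_⟩, hμ⟩
        rw [hdj, Complex.ofReal_re]
      rw [hdj] at hcol ⊢
      obtain ⟨hj1, hj2, -⟩ := hJ μ hμ
      have h1 := hS1 μ hμN _ hcol
      have h2 := hS1 μ hμN _ (hj2 (V.col j))
      rw [hj1 _ hcol, smul_neg, ← sub_eq_add_neg] at h2
      rw [exp_mulVec_of_complex_structure h1 h2, exp_equivariantLog_of_neg hμ, neg_neg]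
    · push Not at hneg
      rw [exp_mulVec_of_mulVec_eq_smul (hS0 _ _ hneg hcol), exp_equivariantLog (hd j) hneg]
  · rw [hS0 1 v (fun μ hμ h => ?_) (by rw [hv, one_smul]), equivariantLog_one, zero_smul]
    have : (1 : ℝ) = μ := by exact_mod_cast h
    linarith

end RealLogarithm

end

/-! ### Assembly of the theorem. -/

theorem theorem2 {M : ℕ} (a h : Fin M → ℝ) (W : Matrix (Fin M) (Fin M) ℝ) (Ω : Finset (Fin M))
    (t₀ Δt : ℝ) (hΔt : 0 < Δt)
    (hinv : IsUnit (recurrenceMatrix a W Ω))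
    (hdiag : IsDiagonalizable (complexify (recurrenceMatrix a W Ω)))
    (hone : (recurrenceMatrix a W Ω).charpoly.eval 1 = 0)
    (n : ℕ) (hn : n = (recurrenceMatrix a W Ω).charpoly.rootMultiplicity 1) :
    -- eigenbases listing the eigenvectors for the eigenvalue 1 first exist
    (∃ (V : Matrix (Fin M) (Fin M) ℂ) (d : Fin M → ℂ),
      IsAdaptedBasis (complexify (recurrenceMatrix a W Ω)) n V ∧
      complexify (recurrenceMatrix a W Ω) = V * Matrix.diagonal d * V⁻¹) ∧
    -- an equivalent continuous-time system exists
    (∃ (L B : Matrix (Fin M) (Fin M) ℂ) (c : Fin M → ℂ),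
      IsConversion (recurrenceMatrix a W Ω) h t₀ Δt n L B c) ∧
    -- with a real matrix under the condition on Jordan blocks
    (EvenNegativeJordanBlocks (complexify (recurrenceMatrix a W Ω)) →
      ∃ (L B : Matrix (Fin M) (Fin M) ℂ) (c : Fin M → ℂ),
        IsConversion (recurrenceMatrix a W Ω) h t₀ Δt n L B c ∧
        ∃ R : Matrix (Fin M) (Fin M) ℝ, B = complexify R) ∧
    -- every logarithm with exactly `n` zero eigenvalues (e.g. the principal one) can be used
    (∀ L : Matrix (Fin M) (Fin M) ℂ,
      NormedSpace.exp L = complexify (recurrenceMatrix a W Ω) →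
      L.charpoly.rootMultiplicity 0 = n →
      ∃ c : Fin M → ℂ,
        IsConversion (recurrenceMatrix a W Ω) h t₀ Δt n L ((Δt : ℂ)⁻¹ • L) c) := by
  set A := recurrenceMatrix a W Ω
  obtain ⟨V, d, hV, hAd⟩ := hdiag
  change complexify A = conjDiag V d at hAd
  have hcp : (complexify A).charpoly = A.charpoly.map Complex.ofRealHom :=
    Matrix.charpoly_map A Complex.ofRealHom
  -- The multiplicity of 1 is unchanged by passing from `ℝ` to `ℂ`, so it can be counted in the
  -- complex eigenvalues.
  have hcard : (Finset.univ.filter fun i => d i = 1).card = n := by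
    rw [← rootMultiplicity_conjDiag hV, ← hAd, hcp, hn,
      Polynomial.eq_rootMultiplicity_map Complex.ofRealHom.injective (1 : ℝ), map_one]
  have hn0 : n ≠ 0 := by
    rw [hn]
    exact (Polynomial.rootMultiplicity_pos (Matrix.charpoly_monic A).ne_zero).2 hone |>.ne'
  have hd : ∀ i, d i ≠ 0 := by
    intro i hi
    have hdet : (conjDiag V d).det = 0 := by
      rw [conjDiag, Matrix.det_mul, Matrix.det_mul, Matrix.det_diagonal,
        Finset.prod_eq_zero (Finset.mem_univ i) hi, mul_zero, zero_mul]
    have hdet' : (complexify A).det = ((A.det : ℝ) : ℂ) := (Complex.ofRealHom.map_det A).symm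
    rw [← hAd, hdet', Complex.ofReal_eq_zero] at hdet
    exact ((Matrix.isUnit_iff_isUnit_det A).1 hinv).ne_zero hdet
  have conv : ∀ L, NormedSpace.exp L = complexify A →
      (∀ v, complexify A *ᵥ v = v → L *ᵥ v = 0) →
      ∃ c : Fin M → ℂ, IsConversion A h t₀ Δt n L ((Δt : ℂ)⁻¹ • L) c := fun L h1 h2 =>
    isConversion_of_eigenspace h t₀ hΔt hV hAd hcard hn0 h1 h2
  refine ⟨?_, ?_, fun hJ => ?_, fun L hexp hL => ?_⟩
  · obtain ⟨V', d', h1, h2⟩ := exists_isAdaptedBasis hV (d := d)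
    rw [hcard, ← hAd] at h1
    exact ⟨V', d', h1, hAd.trans h2⟩
  · obtain ⟨L, h1, h2⟩ := exists_log_mulVec_eq_zero hV hd
    rw [← hAd] at h1 h2
    obtain ⟨c, hc⟩ := conv L h1 h2
    exact ⟨L, _, c, hc⟩
  · obtain ⟨S, h1, h2⟩ := exists_real_log hV hAd hd fun μ hμ => by
      rw [← rootMultiplicity_conjDiag hV, ← hAd]
      exact hJ.even_rootMultiplicity hμ
    obtain ⟨c, hc⟩ := conv _ h1 h2
    refine ⟨_, _, c, hc, Δt⁻¹ • S, ?_⟩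
    ext i j
    simp [complexify]
  · exact conv L hexp fun v hv => log_mulVec_eq_zero hV hAd hexp (hL.trans hcard.symm) hv
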